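/- For a positive integer $n$, let $\mathrm{GHD}_{n,n/2,\sqrt n}:\{0,1\}^n\times\{0,1\}^n\to\{0,1,\star\}$ be the partial function (Gap-Hamming-Distance) $$\mathrm{GHD}_{n,n/2,\sqrt n}(x,y)=\begin{cases}0,&\text{if }\Delta(x,y)\le n/2-\sqrt n,\\ 1,&\text{if }\Delta(x,y)>n/2+\sqrt n,\\ \star,&\text{otherwise,}\end{cases}$$ where $\Delta$ denotes Hamming distance. Let $R(\mathrm{GHD}_{n,n/2,\sqrt n})$ be its randomized two-way communication complexity with error $1/3$: the minimum, over all public-coin randomized protocols $P$ between Alice (who receives $x$) and Bob (who receives $y$) such that $\Pr[P(x,y)\ne \mathrm{GHD}_{n,n/2,\sqrt n}(x,y)]\le 1/3$ for every $(x,y)$ with $\mathrm{GHD}_{n,n/2,\sqrt n}(x,y)\neq\star$, of the worst-case number of bits that $P$ communicates over all inputs and all coin outcomes. (The output of a protocol is determined by the public coins and the transcript.) Then $$R(\mathrm{GHD}_{n,n/2,\sqrt n})=\Omega(n),$$ that is, there is an absolute constant $c>0$ such that $R(\mathrm{GHD}_{n,n/2,\sqrt n})\ge c\,n$ for all sufficiently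 large $n$. -/

import Mathlib

open MeasureTheory Filter
open scoped ENNReal

namespace CommComplexity

/-- A deterministic two-way two-party communication protocol with inputs in `X × Y` and Boolean
output, as a binary tree. At an internal node the player who owns it sends one bit, a function
of that player's own input (and of the transcript so far, that is, of the node); both players
then move to the first subtree if the bit is `false` and to the second one if it is `true`.
A leaf carries the output. -/
inductive Protocol (X Y : Type) : Type
  | leaf (z : Bool) : Protocol X Y
  | alice (send : X → Bool) (ifFalse ifTrue : Protocol X Y) : Protocol X Y
  | bob (send : Y → Bool) (ifFalse ifTrue : Protocol X Y) : Protocol X Y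

/-- The output of the protocol on the input `(x, y)`. -/
def Protocol.output {X Y : Type} : Protocol X Y → X → Y → Bool
  | .leaf z, _, _ => z
  | .alice send p q, x, y => if send x then q.output x y else p.output x y
  | .bob send p q, x, y => if send y then q.output x y else p.output x y

/-- The number of bits exchanged when the protocol runs on the input `(x, y)`. -/
def Protocol.bits {X Y : Type} : Protocol X Y → X → Y → ℕ
  | .leaf _, _, _ => 0
  | .alice send p q, x, y => (if send x then q.bits x y else p.bits x y) + 1
  | .bob send p q, x, y => (if send y then q.bits x y else p.bits x y) + 1

/-- A randomized (public-coin) protocol: the players see a common random point `ω` of a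
probability space and then run the deterministic protocol `proto ω`. The output on each input
is a random variable. Private coins of either player are the special case in which `ω` has
components on which only the messages of one player depend. -/
structure RandomizedProtocol (X Y : Type) where
  Ω : Type
  [measurableSpace : MeasurableSpace Ω]
  μ : Measure Ω
  [isProbabilityMeasure : IsProbabilityMeasure μ]
  proto : Ω → Protocol X Y
  measurable_output : ∀ x y, Measurable fun ω => (proto ω).output x y

/-- The worst-case number of bits communicated, over all inputs and all outcomes of the coins. -/
noncomputable def RandomizedProtocol.cost {X Y : Type} (P : RandomizedProtocol X Y) : ℕ∞ :=
  ⨆ (ω : P.Ω) (x : X) (y : Y), ((P.proto ω).bits x y : ℕ∞)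

/-- `P` computes the partial function `f` with error at most `ε`; the value `none` of `f` marks
the inputs on which any output is allowed. -/
def RandomizedProtocol.ComputesWithError {X Y : Type} (P : RandomizedProtocol X Y)
    (f : X → Y → Option Bool) (ε : ℝ) : Prop :=
  letI := P.measurableSpace
  ∀ x y z, f x y = some z → P.μ.real {ω | (P.proto ω).output x y ≠ z} ≤ ε

/-- The `ε`-error randomized communication complexity of `f`: the least cost of a randomized
protocol that computes `f` with error at most `ε`. -/
noncomputable def randomizedComplexity {X Y : Type} (ε : ℝ) (f : X → Y → Option Bool) : ℕ∞ :=
  ⨅ (P : RandomizedProtocol X Y) (_ : P.ComputesWithError f ε), P.cost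

/-- The Gap-Hamming-Distance problem with threshold `t` and gap `g` on `n`-bit strings
(output `0` is `false`, output `1` is `true`, and `none` means that any output is allowed). -/
noncomputable def ghd (n : ℕ) (t g : ℝ) (x y : Fin n → Bool) : Option Bool :=
  if (hammingDist x y : ℝ) ≤ t - g then some false
  else if t + g < (hammingDist x y : ℝ) then some true
  else none

end CommComplexity

/-!
The proof is a second-moment version of the rectangle bound for Gap-Orthogonality, for the uniform
distribution on pairs of sign vectors `x, y` of dimension `m`.

If `A` is a set of at least `2 ^ m * exp (-δ m)` sign vectors, its second-moment matrix `E_A[x xᵀ]`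
is nearly the identity: the exponential moment of the squared length of the projection to a
`k`-dimensional subspace is at most the Gaussian one (`sum_exp_sum_sq_inner_le`), so its average
over `A` is at most `k + m / 10` (`sum_mul_sum_sq_inner_le`). As the trace is exactly `m`, few
eigenvalues can be small. Hence for two such sets `E_{A × B}[⟨x, y⟩²]`, the trace of the product of
the two matrices, is at least `m / 4` (`le_sum_sum_mul_corr_sq`), and the test function
`⟨x, y⟩² - m / 4` has exponentially small negative part on every rectangle
(`rectangle_lower_bound`).

A randomized protocol of cost `C` accepts with a probability that is a nonnegative combination of
rectangles of total weight `2 ^ C` (`rectCone_randomizedProtocol`), and such combinations are closed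
under products, so no explicit error reduction is needed: let `p` be the acceptance probability of a
protocol that separates `⟨x, y⟩ ≥ -√m / 4` from `⟨x, y⟩ < -√m / 2` with error `1 / 3`, and
`q = (p (x, y) * p (x, ¬y)) ^ 20`. Then `q ≥ (4 / 9) ^ 20` if `|⟨x, y⟩| ≤ √m / 4`, which has
constant probability (`le_sum_corr_small`), and `q ≤ (1 / 3) ^ 20` if `|⟨x, y⟩| > √m / 2`, while in
between the test function is not positive. So the correlation of `q` with the test function is at
most a negative constant times `m`, which forces `2 ^ (40 * C)` to be exponential in `m`
(`exp_le_of_rectCone`). Repeating bits and padding turns a protocol for Gap-Hamming-Distance into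
such a `p` (`cost_lower_bound`).
-/

namespace GapHamming

/-! ### Random sign vectors and the second moment of large sets -/

open ProbabilityTheory

/-- The sign `±1` of a bit: `false` becomes `1` and `true` becomes `-1`. -/
def sgn (b : Bool) : ℝ := if b then -1 else 1

@[simp] lemma sgn_true : sgn true = -1 := rfl

@[simp] lemma sgn_false : sgn false = 1 := rfl

lemma sgn_mul_self (b : Bool) : sgn b * sgn b = 1 := by cases b <;> norm_num

/-- The `±1` vector of a bit string, as a vector of Euclidean space. -/
noncomputable def signVec {ι : Type*} (x : ι → Bool) : EuclideanSpace ℝ ι :=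
  WithLp.toLp 2 fun i => sgn (x i)

/-- The inner product of the `±1` vectors of two bit strings. -/
def corr {ι : Type*} [Fintype ι] (x y : ι → Bool) : ℝ := ∑ i, sgn (x i) * sgn (y i)

lemma inner_signVec {ι : Type*} [Fintype ι] (v : EuclideanSpace ℝ ι) (x : ι → Bool) :
    inner ℝ (signVec x) v = ∑ i, sgn (x i) * v i := by
  simp [signVec, PiLp.inner_apply, mul_comm]

lemma inner_signVec_signVec {ι : Type*} [Fintype ι] (x y : ι → Bool) :
    inner ℝ (signVec x) (signVec y) = corr x y := by
  rw [inner_signVec]; rfl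

lemma integral_exp_mul_sq_gaussianReal {l : ℝ} (hl : l < 1 / 2) :
    ∫ g, Real.exp (l * g ^ 2) ∂(gaussianReal 0 1) = (√(1 - 2 * l))⁻¹ := by
  rw [integral_gaussianReal_eq_integral_smul one_ne_zero]
  have h : ∀ g : ℝ, gaussianPDFReal 0 1 g • Real.exp (l * g ^ 2)
      = (√(2 * Real.pi))⁻¹ * Real.exp (-(1 / 2 - l) * g ^ 2) := by
    intro g
    rw [gaussianPDFReal_def, smul_eq_mul, mul_assoc, ← Real.exp_add]
    congr 2
    · simp
    · simp; ring
  simp_rw [h]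
  rw [integral_const_mul, integral_gaussian, ← Real.sqrt_inv, ← Real.sqrt_inv,
    ← Real.sqrt_mul (by positivity)]
  congr 1
  have : 1 - 2 * l ≠ 0 := by linarith
  have h2 : (1 / 2 - l) ≠ 0 := by linarith
  field_simp

lemma integrable_exp_mul_sq_gaussianReal {l : ℝ} (hl : l < 1 / 2) :
    Integrable (fun g => Real.exp (l * g ^ 2)) (gaussianReal 0 1) := by
  by_contra h
  have h1 := integral_exp_mul_sq_gaussianReal hl
  rw [integral_undef h] at h1
  have : 0 < (√(1 - 2 * l))⁻¹ := by
    have : 0 < 1 - 2 * l := by linarith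
    positivity
  linarith

lemma integral_exp_mul_gaussianReal (t : ℝ) :
    ∫ g, Real.exp (t * g) ∂(gaussianReal 0 1) = Real.exp (t ^ 2 / 2) := by
  have h := congrFun (mgf_id_gaussianReal (μ := 0) (v := 1)) t
  simpa [mgf] using h

/-- A Rademacher sum is sub-Gaussian. -/
lemma sum_exp_inner_signVec_le {ι : Type*} [Fintype ι] [DecidableEq ι] (v : EuclideanSpace ℝ ι) :
    ∑ x : ι → Bool, Real.exp (inner ℝ (signVec x) v)
      ≤ 2 ^ Fintype.card ι * Real.exp (‖v‖ ^ 2 / 2) := by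
  have h1 : ∀ x : ι → Bool, Real.exp (inner ℝ (signVec x) v)
      = ∏ i, Real.exp (sgn (x i) * v i) := by
    intro x; rw [inner_signVec, Real.exp_sum]
  simp_rw [h1]
  have h2 := Finset.prod_univ_sum (fun _ : ι => (Finset.univ : Finset Bool))
    (fun i b => Real.exp (sgn b * v i))
  rw [Fintype.piFinset_univ] at h2
  rw [← h2, EuclideanSpace.norm_sq_eq, Finset.sum_div, Real.exp_sum]
  have h3 : (2 : ℝ) ^ Fintype.card ι = ∏ _i : ι, (2 : ℝ) := by simp
  rw [h3, ← Finset.prod_mul_distrib]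
  refine Finset.prod_le_prod (fun i _ => by positivity) fun i _ => ?_
  have h4 := Real.cosh_le_exp_half_sq (v i)
  rw [Real.cosh_eq] at h4
  simp only [Fintype.sum_bool, sgn_true, sgn_false, neg_mul, one_mul, Real.norm_eq_abs, sq_abs]
  linarith

/-- The exponential moment of the squared length of the projection of a random sign vector to the
span of an orthonormal family is at most that of a standard Gaussian vector. The square in the
exponent is linearized with an auxiliary Gaussian vector `g`. -/
lemma sum_exp_sum_sq_inner_le {ι κ : Type*} [Fintype ι] [DecidableEq ι] [Fintype κ]
    {u : κ → EuclideanSpace ℝ ι} (hu : Orthonormal ℝ u) {l : ℝ} (hl0 : 0 ≤ l) (hl : l < 1 / 2) :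
    ∑ x : ι → Bool, Real.exp (l * ∑ k, inner ℝ (signVec x) (u k) ^ 2)
      ≤ 2 ^ Fintype.card ι * ((√(1 - 2 * l))⁻¹) ^ Fintype.card κ := by
  set c := √(2 * l) with hc
  have hc2 : c ^ 2 = 2 * l := Real.sq_sqrt (by linarith)
  set G : Measure (κ → ℝ) := Measure.pi fun _ => gaussianReal 0 1 with hG
  have h1 : ∀ x : ι → Bool, Real.exp (l * ∑ k, inner ℝ (signVec x) (u k) ^ 2)
      = ∫ g, ∏ k, Real.exp ((c * inner ℝ (signVec x) (u k)) * g k) ∂G := by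
    intro x
    rw [hG, integral_fintype_prod_eq_prod
      (fun k (t : ℝ) => Real.exp ((c * inner ℝ (signVec x) (u k)) * t)), Finset.mul_sum,
      Real.exp_sum]
    refine Finset.prod_congr rfl fun k _ => ?_
    rw [integral_exp_mul_gaussianReal, mul_pow, hc2]
    congr 1; ring
  have hint : ∀ x : ι → Bool,
      Integrable (fun g => ∏ k, Real.exp ((c * inner ℝ (signVec x) (u k)) * g k)) G := fun x =>
    Integrable.fintype_prod (f := fun k (t : ℝ) => Real.exp ((c * inner ℝ (signVec x) (u k)) * t))
      fun k => integrable_exp_mul_gaussianReal _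
  have hint2 : Integrable (fun g : κ → ℝ => ∏ k, Real.exp (l * g k ^ 2)) G :=
    Integrable.fintype_prod (f := fun _ (t : ℝ) => Real.exp (l * t ^ 2))
      fun k => integrable_exp_mul_sq_gaussianReal hl
  simp_rw [h1]
  rw [← integral_finsetSum _ fun x _ => hint x]
  calc ∫ g, ∑ x : ι → Bool, ∏ k, Real.exp ((c * inner ℝ (signVec x) (u k)) * g k) ∂G
      ≤ ∫ g, 2 ^ Fintype.card ι * ∏ k, Real.exp (l * g k ^ 2) ∂G := by
        refine integral_mono (integrable_finsetSum _ fun x _ => hint x)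
          (hint2.const_mul _) fun g => ?_
        have h2 := sum_exp_inner_signVec_le (∑ k, (c * g k) • u k)
        have h3 : ‖∑ k, (c * g k) • u k‖ ^ 2 / 2 = ∑ k, l * g k ^ 2 := by
          rw [← real_inner_self_eq_norm_sq, hu.inner_sum, Finset.sum_div]
          refine Finset.sum_congr rfl fun k _ => ?_
          simp only [conj_trivial]
          linear_combination (g k ^ 2 / 2) * hc2
        rw [h3, Real.exp_sum] at h2
        refine le_trans (le_of_eq (Finset.sum_congr rfl fun x _ => ?_)) h2
        rw [← Real.exp_sum, inner_sum]
        congr 1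
        refine Finset.sum_congr rfl fun k _ => ?_
        rw [inner_smul_right]; ring
    _ = _ := by
        rw [integral_const_mul, hG, integral_fintype_prod_eq_prod
          (fun _ (t : ℝ) => Real.exp (l * t ^ 2))]
        simp [integral_exp_mul_sq_gaussianReal hl]

/-- A weight `a` on the cube of total mass at least `2 ^ n * exp (-n / 1600)` is nearly isotropic
from above: the squared length of the projection to a `k`-dimensional subspace has `a`-average at
most `k + n / 10`. -/
lemma sum_mul_sum_sq_inner_le {ι κ : Type*} [Fintype ι] [DecidableEq ι] [Fintype κ]
    {u : κ → EuclideanSpace ℝ ι} (hu : Orthonormal ℝ u) {a : (ι → Bool) → ℝ}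
    (ha0 : ∀ x, 0 ≤ a x) (ha1 : ∀ x, a x ≤ 1)
    (ha : 2 ^ Fintype.card ι * Real.exp (-(Fintype.card ι : ℝ) / 1600) ≤ ∑ x, a x) :
    ∑ x, a x * ∑ k, inner ℝ (signVec x) (u k) ^ 2
      ≤ (∑ x, a x) * (Fintype.card κ + Fintype.card ι / 10) := by
  set α := ∑ x, a x with hα
  set m : ℝ := (Fintype.card ι : ℝ) with hm
  set Z : (ι → Bool) → ℝ := fun x => ∑ k, inner ℝ (signVec x) (u k) ^ 2 with hZ
  have hαpos : 0 < α := lt_of_lt_of_le (by positivity) ha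
  have hkm : (Fintype.card κ : ℝ) ≤ m := by
    have := hu.linearIndependent.fintype_card_le_finrank
    rw [finrank_euclideanSpace] at this
    rw [hm]; exact_mod_cast this
  -- The tangent of `exp` at `v` bounds `exp (l * Z x)` below; `l = 1 / 80` throughout.
  set v : ℝ := m / 1600 + Fintype.card κ * (1 / 78) with hv
  have h1 := sum_exp_sum_sq_inner_le hu (l := 1 / 80) (by norm_num) (by norm_num)
  have hs : (√(1 - 2 * (1 / 80) : ℝ))⁻¹ ≤ Real.exp (1 / 78) := by
    rw [← Real.sqrt_inv]
    apply Real.sqrt_le_left (by positivity) |>.2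
    rw [← Real.exp_nat_mul]
    have := Real.add_one_le_exp ((2 : ℕ) * (1 / 78) : ℝ)
    refine le_trans ?_ this
    norm_num
  have h2 : ∑ x, a x * Real.exp (1 / 80 * Z x) ≤ α * Real.exp v := by
    calc ∑ x, a x * Real.exp (1 / 80 * Z x) ≤ ∑ x, Real.exp (1 / 80 * Z x) :=
          Finset.sum_le_sum fun x _ => mul_le_of_le_one_left (by positivity) (ha1 x)
      _ ≤ 2 ^ Fintype.card ι * ((√(1 - 2 * (1 / 80) : ℝ))⁻¹) ^ Fintype.card κ := h1
      _ ≤ 2 ^ Fintype.card ι * (Real.exp (1 / 78)) ^ Fintype.card κ := by gcongr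
      _ = 2 ^ Fintype.card ι * Real.exp (-m / 1600) * Real.exp v := by
          rw [← Real.exp_nat_mul, mul_assoc, ← Real.exp_add]
          congr 2; rw [hv]; ring
      _ ≤ _ := by gcongr
  have h3 : ∑ x, a x * (Real.exp v * (1 + (1 / 80 * Z x - v))) ≤ α * Real.exp v := by
    refine le_trans (Finset.sum_le_sum fun x _ => mul_le_mul_of_nonneg_left ?_ (ha0 x)) h2
    have := Real.add_one_le_exp (1 / 80 * Z x - v)
    calc Real.exp v * (1 + (1 / 80 * Z x - v)) ≤ Real.exp v * Real.exp (1 / 80 * Z x - v) := by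
          gcongr; linarith
      _ = _ := by rw [← Real.exp_add]; congr 1; ring
  have h4 : ∑ x, a x * (Real.exp v * (1 + (1 / 80 * Z x - v)))
      = Real.exp v * (α * (1 - v) + 1 / 80 * ∑ x, a x * Z x) := by
    rw [hα, Finset.sum_mul, Finset.mul_sum, ← Finset.sum_add_distrib, Finset.mul_sum]
    exact Finset.sum_congr rfl fun x _ => by ring
  rw [h4, mul_comm α (Real.exp v)] at h3
  have h5 := le_of_mul_le_mul_left h3 (Real.exp_pos v)
  have h6 : v * 80 ≤ Fintype.card κ + m / 10 := by rw [hv]; linarith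
  nlinarith

/-- Diagonalization of the second-moment form of a weight on the cube. -/
lemma exists_orthonormalBasis_sum_sq {ι : Type*} [Fintype ι] [DecidableEq ι] (a : (ι → Bool) → ℝ) :
    ∃ u : OrthonormalBasis (Fin (Fintype.card ι)) ℝ (EuclideanSpace ℝ ι),
      ∀ v : EuclideanSpace ℝ ι, ∑ x, a x * inner ℝ (signVec x) v ^ 2
        = ∑ k, (∑ x, a x * inner ℝ (signVec x) (u k) ^ 2) * inner ℝ v (u k) ^ 2 := by
  let T : EuclideanSpace ℝ ι →ₗ[ℝ] EuclideanSpace ℝ ι :=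
    ∑ x : ι → Bool, a x • (innerₛₗ ℝ (signVec x)).smulRight (signVec x)
  have hT : ∀ v w, inner ℝ (T v) w
      = ∑ x, a x * (inner ℝ (signVec x) v * inner ℝ (signVec x) w) := by
    intro v w
    simp only [T, LinearMap.sum_apply, LinearMap.smul_apply, LinearMap.smulRight_apply,
      sum_inner, inner_smul_left, innerₛₗ_apply_apply, conj_trivial]
  have hsymm : T.IsSymmetric := by
    intro v w
    rw [hT, real_inner_comm, hT]
    exact Finset.sum_congr rfl fun x _ => by ring
  have hn : Module.finrank ℝ (EuclideanSpace ℝ ι) = Fintype.card ι := finrank_euclideanSpace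
  refine ⟨hsymm.eigenvectorBasis hn, fun v => ?_⟩
  set u := hsymm.eigenvectorBasis hn with hu
  have hmu : ∀ k, ∑ x, a x * inner ℝ (signVec x) (u k) ^ 2 = hsymm.eigenvalues hn k := by
    intro k
    have h := hT (u k) (u k)
    rw [hu, hsymm.apply_eigenvectorBasis hn k, ← hu, inner_smul_left,
      real_inner_self_eq_norm_sq, u.orthonormal.1 k] at h
    simp only [RCLike.ofReal_real_eq_id, id, conj_trivial, one_pow, mul_one] at h
    rw [h]
    exact Finset.sum_congr rfl fun x _ => by ring
  calc ∑ x, a x * inner ℝ (signVec x) v ^ 2 = inner ℝ (T v) v := by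
        rw [hT]; exact Finset.sum_congr rfl fun x _ => by ring
    _ = ∑ k, inner ℝ (T v) (u k) * inner ℝ (u k) v := (u.sum_inner_mul_inner _ _).symm
    _ = _ := by
        refine Finset.sum_congr rfl fun k _ => ?_
        rw [hmu, hsymm v (u k), hu, hsymm.apply_eigenvectorBasis hn k, ← hu, inner_smul_right,
          real_inner_comm v (u k)]
        simp only [RCLike.ofReal_real_eq_id, id]
        ring

lemma norm_sq_signVec {ι : Type*} [Fintype ι] (x : ι → Bool) :
    ‖signVec x‖ ^ 2 = Fintype.card ι := by
  rw [← real_inner_self_eq_norm_sq, inner_signVec_signVec, corr]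
  simp [sgn_mul_self]

/-! ### The second moment of the inner product over rectangles -/

lemma sum_mul_sum_sq_inner_restrict_le {ι κ : Type*} [Fintype ι] [DecidableEq ι] [Fintype κ]
    [DecidableEq κ] {u : κ → EuclideanSpace ℝ ι} (hu : Orthonormal ℝ u) {a : (ι → Bool) → ℝ}
    (ha0 : ∀ x, 0 ≤ a x) (ha1 : ∀ x, a x ≤ 1)
    (ha : 2 ^ Fintype.card ι * Real.exp (-(Fintype.card ι : ℝ) / 1600) ≤ ∑ x, a x)
    (S : Finset κ) :
    ∑ k ∈ S, ∑ x, a x * inner ℝ (signVec x) (u k) ^ 2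
      ≤ (∑ x, a x) * (S.card + Fintype.card ι / 10) := by
  have h := sum_mul_sum_sq_inner_le (hu.comp (fun k : S => (k : κ)) Subtype.val_injective)
    ha0 ha1 ha
  rw [Fintype.card_coe] at h
  refine le_trans (le_of_eq ?_) h
  rw [Finset.sum_comm]
  refine Finset.sum_congr rfl fun x _ => ?_
  rw [← Finset.mul_sum]
  congr 1
  exact (Finset.sum_coe_sort S fun k => inner ℝ (signVec x) (u k) ^ 2).symm

lemma sum_sum_mul_sq_inner_basis {ι κ : Type*} [Fintype ι] [DecidableEq ι] [Fintype κ]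
    (u : OrthonormalBasis κ ℝ (EuclideanSpace ℝ ι)) (a : (ι → Bool) → ℝ) :
    ∑ k, ∑ x, a x * inner ℝ (signVec x) (u k) ^ 2 = (∑ x, a x) * Fintype.card ι := by
  rw [Finset.sum_comm, Finset.sum_mul]
  refine Finset.sum_congr rfl fun x _ => ?_
  rw [← Finset.mul_sum, u.sum_sq_inner_left, norm_sq_signVec]

/-- Under the product of two weights of large mass, the squared inner product averages to at least
a quarter of the dimension. In the eigenbasis of the second-moment form of `a`, at most a fifth of
the eigenvalues lie below half the mass of `a`, and `b` puts little of its second moment on the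
corresponding eigenvectors. -/
lemma le_sum_sum_mul_corr_sq {ι : Type*} [Fintype ι] [DecidableEq ι] {a b : (ι → Bool) → ℝ}
    (ha0 : ∀ x, 0 ≤ a x) (ha1 : ∀ x, a x ≤ 1) (hb0 : ∀ x, 0 ≤ b x) (hb1 : ∀ x, b x ≤ 1)
    (ha : 2 ^ Fintype.card ι * Real.exp (-(Fintype.card ι : ℝ) / 1600) ≤ ∑ x, a x)
    (hb : 2 ^ Fintype.card ι * Real.exp (-(Fintype.card ι : ℝ) / 1600) ≤ ∑ x, b x) :
    (∑ x, a x) * (∑ y, b y) * (Fintype.card ι / 4)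
      ≤ ∑ x, ∑ y, a x * b y * corr x y ^ 2 := by
  obtain ⟨u, hu⟩ := exists_orthonormalBasis_sum_sq a
  set M : Fin (Fintype.card ι) → ℝ := fun k => ∑ x, a x * inner ℝ (signVec x) (u k) ^ 2 with hM
  set N : Fin (Fintype.card ι) → ℝ := fun k => ∑ x, b x * inner ℝ (signVec x) (u k) ^ 2 with hN
  set α := ∑ x, a x with hα
  set β := ∑ x, b x with hβ
  set m : ℝ := (Fintype.card ι : ℝ) with hm
  have hα0 : 0 < α := lt_of_lt_of_le (by positivity) ha
  have hβ0 : 0 < β := lt_of_lt_of_le (by positivity) hb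
  have hm0 : 0 ≤ m := by positivity
  have hM0 : ∀ k, 0 ≤ M k := fun k => Finset.sum_nonneg fun x _ => mul_nonneg (ha0 x) (sq_nonneg _)
  have hN0 : ∀ k, 0 ≤ N k := fun k => Finset.sum_nonneg fun x _ => mul_nonneg (hb0 x) (sq_nonneg _)
  have hexp : ∑ x, ∑ y, a x * b y * corr x y ^ 2 = ∑ k, M k * N k := by
    rw [Finset.sum_comm]
    calc ∑ y, ∑ x, a x * b y * corr x y ^ 2
        = ∑ y, b y * ∑ k, M k * inner ℝ (signVec y) (u k) ^ 2 := by
          refine Finset.sum_congr rfl fun y _ => ?_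
          rw [← hu (signVec y), Finset.mul_sum]
          refine Finset.sum_congr rfl fun x _ => ?_
          rw [inner_signVec_signVec]; ring
      _ = _ := by
          simp_rw [Finset.mul_sum]
          rw [Finset.sum_comm]
          refine Finset.sum_congr rfl fun k _ => ?_
          rw [hN, Finset.mul_sum]
          exact Finset.sum_congr rfl fun x _ => by ring
  set S : Finset (Fin (Fintype.card ι)) := Finset.univ.filter fun k => M k < α / 2 with hS
  have hMtot : ∑ k, M k = α * m := sum_sum_mul_sq_inner_basis u a
  have hNtot : ∑ k, N k = β * m := sum_sum_mul_sq_inner_basis u b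
  have hMc : ∑ k ∈ Sᶜ, M k ≤ α * ((Sᶜ.card : ℝ) + m / 10) :=
    sum_mul_sum_sq_inner_restrict_le u.orthonormal ha0 ha1 ha Sᶜ
  have hNS : ∑ k ∈ S, N k ≤ β * ((S.card : ℝ) + m / 10) :=
    sum_mul_sum_sq_inner_restrict_le u.orthonormal hb0 hb1 hb S
  have hcard : (S.card : ℝ) + (Sᶜ.card : ℝ) = m := by
    have := Finset.card_add_card_compl S
    rw [Fintype.card_fin] at this
    rw [hm]; exact_mod_cast this
  have hMS : ∑ k ∈ S, M k ≤ S.card * (α / 2) := by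
    rw [← nsmul_eq_mul]
    exact Finset.sum_le_card_nsmul _ _ _ fun k hk => (Finset.mem_filter.1 hk).2.le
  have hMsplit := Finset.sum_add_sum_compl S M
  have hNsplit := Finset.sum_add_sum_compl S N
  have hS5 : (S.card : ℝ) ≤ m / 5 := by
    have : α * (S.card / 2) ≤ α * (m / 10) := by nlinarith
    have := le_of_mul_le_mul_left this hα0
    linarith
  rw [hexp]
  have h1 : α / 2 * ∑ k ∈ Sᶜ, N k ≤ ∑ k, M k * N k := by
    rw [Finset.mul_sum]
    refine le_trans (Finset.sum_le_sum fun k hk => ?_)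
      (Finset.sum_le_univ_sum_of_nonneg fun k => mul_nonneg (hM0 k) (hN0 k))
    refine mul_le_mul_of_nonneg_right ?_ (hN0 k)
    have : ¬ M k < α / 2 := fun h => (Finset.mem_compl.1 hk) (by simp [hS, h])
    linarith
  have h2 : β * (m / 2) ≤ ∑ k ∈ Sᶜ, N k := by nlinarith
  nlinarith

/-- The function `x, y ↦ corr x y ^ 2 - n / 4` has small negative part against rectangles. -/
lemma rectangle_lower_bound {ι : Type*} [Fintype ι] [DecidableEq ι] {a b : (ι → Bool) → ℝ}
    (ha0 : ∀ x, 0 ≤ a x) (ha1 : ∀ x, a x ≤ 1) (hb0 : ∀ x, 0 ≤ b x) (hb1 : ∀ x, b x ≤ 1) :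
    -(Fintype.card ι / 4 * 4 ^ Fintype.card ι * Real.exp (-(Fintype.card ι : ℝ) / 1600))
      ≤ ∑ x, ∑ y, a x * b y * (corr x y ^ 2 - Fintype.card ι / 4) := by
  set m : ℝ := (Fintype.card ι : ℝ) with hm
  have hsplit : ∑ x, ∑ y, a x * b y * (corr x y ^ 2 - m / 4)
      = ∑ x, ∑ y, a x * b y * corr x y ^ 2 - (∑ x, a x) * (∑ y, b y) * (m / 4) := by
    rw [Finset.sum_mul_sum, Finset.sum_mul, ← Finset.sum_sub_distrib]
    refine Finset.sum_congr rfl fun x _ => ?_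
    rw [Finset.sum_mul, ← Finset.sum_sub_distrib]
    exact Finset.sum_congr rfl fun y _ => by ring
  have hm0 : 0 ≤ m := by positivity
  have h4 : (4 : ℝ) ^ Fintype.card ι = 2 ^ Fintype.card ι * 2 ^ Fintype.card ι := by
    rw [← mul_pow]; norm_num
  have hle : ∀ {c : (ι → Bool) → ℝ}, (∀ x, c x ≤ 1) → ∑ x, c x ≤ 2 ^ Fintype.card ι := by
    intro c hc
    refine le_trans (Finset.sum_le_card_nsmul _ _ 1 fun x _ => hc x) ?_
    simp
  have hα := hle ha1
  have hβ := hle hb1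
  have hα0 : 0 ≤ ∑ x, a x := Finset.sum_nonneg fun x _ => ha0 x
  have hβ0 : 0 ≤ ∑ x, b x := Finset.sum_nonneg fun x _ => hb0 x
  have hnn : 0 ≤ ∑ x, ∑ y, a x * b y * corr x y ^ 2 :=
    Finset.sum_nonneg fun x _ => Finset.sum_nonneg fun y _ =>
      mul_nonneg (mul_nonneg (ha0 x) (hb0 y)) (sq_nonneg _)
  rw [hsplit]
  have key : (∑ x, a x) * (∑ y, b y) ≤ 4 ^ Fintype.card ι * Real.exp (-m / 1600) →
      -(m / 4 * 4 ^ Fintype.card ι * Real.exp (-m / 1600))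
        ≤ ∑ x, ∑ y, a x * b y * corr x y ^ 2 - (∑ x, a x) * (∑ y, b y) * (m / 4) := by
    intro h
    have := mul_le_mul_of_nonneg_right h (by positivity : 0 ≤ m / 4)
    linarith
  by_cases ha : 2 ^ Fintype.card ι * Real.exp (-m / 1600) ≤ ∑ x, a x
  · by_cases hb : 2 ^ Fintype.card ι * Real.exp (-m / 1600) ≤ ∑ y, b y
    · have := le_sum_sum_mul_corr_sq ha0 ha1 hb0 hb1 ha hb
      have h0 : 0 ≤ m / 4 * 4 ^ Fintype.card ι * Real.exp (-m / 1600) := by positivity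
      linarith
    · apply key
      rw [h4, mul_assoc]
      exact mul_le_mul hα (not_le.1 hb).le hβ0 (by positivity)
  · apply key
    rw [h4, mul_assoc, mul_comm (∑ x, a x)]
    exact mul_le_mul hβ (not_le.1 ha).le hα0 (by positivity)

/-! ### Anticoncentration of Rademacher sums -/

lemma sgn_not (b : Bool) : sgn (!b) = -sgn b := by cases b <;> simp

lemma sgn_xor (b c : Bool) : sgn (b ^^ c) = sgn b * sgn c := by cases b <;> cases c <;> simp

lemma corr_not_right {ι : Type*} [Fintype ι] (x y : ι → Bool) :
    corr x (fun i => !y i) = -corr x y := by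
  simp [corr, sgn_not]

lemma sum_sgn_mul_sgn {ι : Type*} [Fintype ι] [DecidableEq ι] (i j : ι) :
    ∑ x : ι → Bool, sgn (x i) * sgn (x j) = if i = j then 2 ^ Fintype.card ι else 0 := by
  split_ifs with h
  · subst h; simp [sgn_mul_self]
  · -- Flipping the bit `i` changes the sign of every term.
    let e : Equiv.Perm (ι → Bool) := Function.Involutive.toPerm
      (fun x => Function.update x i (!x i)) (fun x => by simp)
    have h1 := Equiv.sum_comp e fun x => sgn (x i) * sgn (x j)
    have h2 : ∀ x, sgn (e x i) * sgn (e x j) = -(sgn (x i) * sgn (x j)) := by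
      intro x
      change sgn (Function.update x i (!x i) i) * sgn (Function.update x i (!x i) j) = _
      simp [Function.update_of_ne (Ne.symm h), sgn_not]
    simp_rw [h2, Finset.sum_neg_distrib] at h1
    linarith

lemma sum_corr_sq {ι : Type*} [Fintype ι] [DecidableEq ι] (y : ι → Bool) :
    ∑ x, corr x y ^ 2 = 2 ^ Fintype.card ι * Fintype.card ι := by
  have h : ∀ x, corr x y ^ 2 = ∑ i, ∑ j, (sgn (y i) * sgn (y j)) * (sgn (x i) * sgn (x j)) := by
    intro x
    rw [corr, sq, Finset.sum_mul_sum]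
    exact Finset.sum_congr rfl fun i _ => Finset.sum_congr rfl fun j _ => by ring
  simp_rw [h]
  rw [Finset.sum_comm]
  calc ∑ i, ∑ x : ι → Bool, ∑ j, (sgn (y i) * sgn (y j)) * (sgn (x i) * sgn (x j))
      = ∑ _i : ι, (2 : ℝ) ^ Fintype.card ι := by
        refine Finset.sum_congr rfl fun i _ => ?_
        rw [Finset.sum_comm]
        simp_rw [← Finset.mul_sum, sum_sgn_mul_sgn]
        simp [sgn_mul_self]
    _ = _ := by simp [mul_comm]

/-- For fixed `y`, the distribution of `corr x y` over uniform `x` does not depend on `y`. -/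
lemma sum_comp_corr {ι : Type*} [Fintype ι] [DecidableEq ι] (f : ℝ → ℝ) (y y' : ι → Bool) :
    ∑ x, f (corr x y) = ∑ x, f (corr x y') := by
  let e : Equiv.Perm (ι → Bool) := Function.Involutive.toPerm
    (fun x i => x i ^^ (y i ^^ y' i)) (fun x => by ext i; simp)
  rw [← Equiv.sum_comp e]
  refine Finset.sum_congr rfl fun x _ => ?_
  congr 1
  refine Finset.sum_congr rfl fun i _ => ?_
  change sgn (x i ^^ (y i ^^ y' i)) * sgn (y i) = _
  rw [sgn_xor, sgn_xor]
  linear_combination (sgn (x i) * sgn (y' i)) * sgn_mul_self (y i)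

/-- Two independent copies of a Rademacher sum of length `k` are within `√(2 * k) / 4` of each other
with constant probability: by Chebyshev's inequality the sum mostly falls into twelve intervals of
this length, and by the Cauchy–Schwarz inequality the copies often share an interval. -/
lemma le_sum_sum_corr_sub_corr_small {κ : Type*} [Fintype κ] [DecidableEq κ] [Nonempty κ]
    (y : κ → Bool) :
    3 / 64 * 4 ^ Fintype.card κ ≤ ∑ z, ∑ z',
      if |corr z y - corr z' y| ≤ √(2 * Fintype.card κ) / 4 then (1 : ℝ) else 0 := by
  set k : ℝ := (Fintype.card κ : ℝ) with hk
  have hk0 : 0 < k := by rw [hk]; exact_mod_cast Fintype.card_pos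
  set w := √(2 * k) / 4 with hw
  have hw0 : 0 < w := by positivity
  have hw2 : w ^ 2 = k / 8 := by
    rw [hw, div_pow, Real.sq_sqrt (by positivity)]; ring
  let h : ℤ → (κ → Bool) → ℝ := fun t z =>
    if t = ⌊corr z y / w⌋ ∧ corr z y ^ 2 < 4 * k then 1 else 0
  have hh0 : ∀ t z, 0 ≤ h t z := fun t z => by
    simp only [h]; split_ifs <;> norm_num
  have hh1 : ∀ t z, h t z ≤ 1 := fun t z => by
    simp only [h]; split_ifs <;> norm_num
  have hsum : ∀ z, ∑ t ∈ Finset.Icc (-6) 5, h t z = if corr z y ^ 2 < 4 * k then 1 else 0 := by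
    intro z
    by_cases hz : corr z y ^ 2 < 4 * k
    · have habs : |corr z y| < 6 * w := abs_lt_of_sq_lt_sq (by nlinarith) (by positivity)
      have hmem : ⌊corr z y / w⌋ ∈ Finset.Icc (-6 : ℤ) 5 := by
        obtain ⟨h1, h2⟩ := abs_lt.1 habs
        rw [Finset.mem_Icc]
        constructor
        · rw [Int.le_floor, le_div_iff₀ hw0]; push_cast; linarith
        · apply Int.lt_add_one_iff.1
          rw [Int.floor_lt, div_lt_iff₀ hw0]; push_cast; linarith
      simp only [h, hz, and_true, if_true]
      rw [Finset.sum_ite_eq' , if_pos hmem]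
    · simp [h, hz]
  have hcheb : 3 / 4 * 2 ^ Fintype.card κ ≤ ∑ t ∈ Finset.Icc (-6) 5, ∑ z, h t z := by
    rw [Finset.sum_comm]
    simp_rw [hsum]
    have h1 : ∑ z, (1 - corr z y ^ 2 / (4 * k)) = 3 / 4 * 2 ^ Fintype.card κ := by
      rw [Finset.sum_sub_distrib, ← Finset.sum_div, sum_corr_sq, ← hk]
      simp
      field_simp
      ring
    rw [← h1]
    refine Finset.sum_le_sum fun z _ => ?_
    have : 0 ≤ corr z y ^ 2 / (4 * k) := by positivity
    split_ifs with hz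
    · linarith
    · have := (one_le_div (by positivity : 0 < 4 * k)).2 (not_lt.1 hz)
      linarith
  have hcs := sq_sum_le_card_mul_sum_sq (s := Finset.Icc (-6 : ℤ) 5) (f := fun t => ∑ z, h t z)
  have hcard : ((Finset.Icc (-6 : ℤ) 5).card : ℝ) = 12 := by simp
  rw [hcard] at hcs
  have hpairs : ∑ t ∈ Finset.Icc (-6 : ℤ) 5, (∑ z, h t z) ^ 2
      ≤ ∑ z, ∑ z', if |corr z y - corr z' y| ≤ w then (1 : ℝ) else 0 := by
    simp_rw [sq, Finset.sum_mul_sum]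
    rw [Finset.sum_comm]
    refine Finset.sum_le_sum fun z _ => ?_
    rw [Finset.sum_comm]
    refine Finset.sum_le_sum fun z' _ => ?_
    split_ifs with hc
    · calc ∑ t ∈ Finset.Icc (-6) 5, h t z * h t z' ≤ ∑ t ∈ Finset.Icc (-6) 5, h t z :=
            Finset.sum_le_sum fun t _ => mul_le_of_le_one_right (hh0 t z) (hh1 t z')
        _ ≤ 1 := by rw [hsum]; split_ifs <;> norm_num
    · refine le_of_eq (Finset.sum_eq_zero fun t _ => ?_)
      by_contra hne
      simp only [h, mul_ite, mul_one, mul_zero] at hne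
      split_ifs at hne with h1 h2
      · apply hc
        have h3 := Int.abs_sub_lt_one_of_floor_eq_floor (h2.1.symm.trans h1.1)
        rw [← sub_div, abs_div, abs_of_pos hw0, div_lt_one hw0] at h3
        exact h3.le
      all_goals exact hne rfl
  have h4 : (4 : ℝ) ^ Fintype.card κ = 2 ^ Fintype.card κ * 2 ^ Fintype.card κ := by
    rw [← mul_pow]; norm_num
  rw [h4]
  have hsq := mul_self_le_mul_self (by positivity) hcheb
  nlinarith

/-- Anticoncentration at the origin: `|corr x y| ≤ √n / 4` with probability at least `3 / 64`. The
even length makes `corr x y` a difference of two independent copies of a shorter sum. -/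
lemma le_sum_corr_small {κ : Type*} [Fintype κ] [DecidableEq κ] [Nonempty κ]
    (y : κ ⊕ κ → Bool) :
    3 / 64 * 2 ^ Fintype.card (κ ⊕ κ) ≤ ∑ x,
      if |corr x y| ≤ √(Fintype.card (κ ⊕ κ)) / 4 then (1 : ℝ) else 0 := by
  have h := le_sum_sum_corr_sub_corr_small fun _ : κ => false
  have hc : (Fintype.card (κ ⊕ κ) : ℝ) = 2 * Fintype.card κ := by
    rw [Fintype.card_sum]; push_cast; ring
  have h2 : (2 : ℝ) ^ Fintype.card (κ ⊕ κ) = 4 ^ Fintype.card κ := by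
    rw [Fintype.card_sum, ← two_mul, pow_mul]; norm_num
  rw [hc, h2]
  refine h.trans (le_of_eq ?_)
  set w := √(2 * (Fintype.card κ : ℝ)) / 4
  rw [sum_comp_corr (fun s => if |s| ≤ w then (1 : ℝ) else 0) y
    (Sum.elim (fun _ => false) fun _ => true),
    ← Equiv.sum_comp (Equiv.sumArrowEquivProdArrow κ κ Bool).symm, Fintype.sum_prod_type]
  refine Finset.sum_congr rfl fun z _ => Finset.sum_congr rfl fun z' _ => ?_
  congr 2
  simp only [corr, Fintype.sum_sum_type]
  simp [sub_eq_add_neg]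

/-! ### Protocols as combinations of rectangles -/

open CommComplexity

/-- `RectCone N q` says that `q` is a nonnegative combination, of total weight at most `N`, of
fractional rectangles `x, y ↦ a x * b y` with `a` and `b` valued in `[0, 1]`. -/
inductive RectCone {X Y : Type} : ℝ → (X → Y → ℝ) → Prop
  | rect (a : X → ℝ) (b : Y → ℝ) (ha0 : ∀ x, 0 ≤ a x) (ha1 : ∀ x, a x ≤ 1)
      (hb0 : ∀ y, 0 ≤ b y) (hb1 : ∀ y, b y ≤ 1) : RectCone 1 fun x y => a x * b y
  | zero : RectCone 0 fun _ _ => 0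
  | add {N M : ℝ} {p q : X → Y → ℝ} (hp : RectCone N p) (hq : RectCone M q) :
      RectCone (N + M) fun x y => p x y + q x y
  | smul {N : ℝ} {q : X → Y → ℝ} (c : ℝ) (hc : 0 ≤ c) (hq : RectCone N q) :
      RectCone (c * N) fun x y => c * q x y
  | mono {N M : ℝ} {q : X → Y → ℝ} (h : N ≤ M) (hq : RectCone N q) : RectCone M q

namespace RectCone

variable {X Y : Type}

lemma nonneg {N : ℝ} {q : X → Y → ℝ} (hq : RectCone N q) : 0 ≤ N := by
  induction hq with
  | rect => norm_num
  | zero => exact le_rfl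
  | add _ _ h1 h2 => exact add_nonneg h1 h2
  | smul c hc _ h => exact mul_nonneg hc h
  | mono h _ h1 => exact h1.trans h

lemma sum {ι : Type*} (s : Finset ι) {N : ι → ℝ} {q : ι → X → Y → ℝ}
    (h : ∀ i ∈ s, RectCone (N i) (q i)) :
    RectCone (∑ i ∈ s, N i) fun x y => ∑ i ∈ s, q i x y := by
  classical
  induction s using Finset.induction_on with
  | empty => simpa using zero
  | insert i s hi ih =>
    simp only [Finset.sum_insert hi]
    exact add (h i (Finset.mem_insert_self i s))
      (ih fun j hj => h j (Finset.mem_insert_of_mem hj))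

lemma mul {N M : ℝ} {p q : X → Y → ℝ} (hp : RectCone N p) (hq : RectCone M q) :
    RectCone (N * M) fun x y => p x y * q x y := by
  induction hp with
  | rect a b ha0 ha1 hb0 hb1 =>
    induction hq with
    | rect a' b' ha0' ha1' hb0' hb1' =>
      have h := rect (X := X) (Y := Y) (fun x => a x * a' x) (fun y => b y * b' y)
        (fun x => mul_nonneg (ha0 x) (ha0' x)) (fun x => mul_le_one₀ (ha1 x) (ha0' x) (ha1' x))
        (fun y => mul_nonneg (hb0 y) (hb0' y)) (fun y => mul_le_one₀ (hb1 y) (hb0' y) (hb1' y))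
      convert h using 1
      · ring
      · ext x y; ring
    | zero => simpa using zero
    | add _ _ h1 h2 =>
      convert h1.add h2 using 1
      · ring
      · ext x y; ring
    | smul c hc _ h =>
      convert h.smul c hc using 1
      · ring
      · ext x y; ring
    | mono hle _ h => exact h.mono (by linarith)
  | zero => simpa using zero
  | add _ _ h1 h2 =>
    convert h1.add h2 using 1
    · ring
    · ext x y; ring
  | smul c hc _ h =>
    convert h.smul c hc using 1
    · ring
    · ext x y; ring
  | mono hle _ h => exact h.mono (mul_le_mul_of_nonneg_right hle hq.nonneg)

lemma pow {N : ℝ} {q : X → Y → ℝ} (hq : RectCone N q) (j : ℕ) :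
    RectCone (N ^ j) fun x y => q x y ^ j := by
  induction j with
  | zero =>
    simpa using rect (X := X) (Y := Y) (fun _ => 1) (fun _ => 1) (fun _ => zero_le_one)
      (fun _ => le_rfl) (fun _ => zero_le_one) (fun _ => le_rfl)
  | succ j ih => simpa only [pow_succ] using ih.mul hq

/-- The players may apply arbitrary maps to their own inputs. -/
lemma comp {X' Y' : Type} {N : ℝ} {q : X → Y → ℝ} (hq : RectCone N q) (f : X' → X) (g : Y' → Y) :
    RectCone N fun x y => q (f x) (g y) := by
  induction hq with
  | rect a b ha0 ha1 hb0 hb1 =>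
    exact rect (fun x => a (f x)) (fun y => b (g y)) (fun x => ha0 _) (fun x => ha1 _)
      (fun x => hb0 _) (fun x => hb1 _)
  | zero => exact zero
  | add _ _ h1 h2 => exact h1.add h2
  | smul c hc _ h => exact h.smul c hc
  | mono hle _ h => exact h.mono hle

lemma neg_mul_le_sum [Fintype X] [Fintype Y] {N B : ℝ} {q : X → Y → ℝ} (hq : RectCone N q)
    (φ : X → Y → ℝ) (hB : 0 ≤ B)
    (hrect : ∀ (a : X → ℝ) (b : Y → ℝ), (∀ x, 0 ≤ a x) → (∀ x, a x ≤ 1) → (∀ y, 0 ≤ b y) →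
      (∀ y, b y ≤ 1) → -B ≤ ∑ x, ∑ y, a x * b y * φ x y) :
    -(N * B) ≤ ∑ x, ∑ y, q x y * φ x y := by
  induction hq with
  | rect a b ha0 ha1 hb0 hb1 => simpa using hrect a b ha0 ha1 hb0 hb1
  | zero => simp
  | add _ _ h1 h2 =>
    simp only [add_mul, Finset.sum_add_distrib]
    linarith
  | smul c hc _ h =>
    simp only [mul_assoc, ← Finset.mul_sum]
    rw [← mul_neg]
    exact mul_le_mul_of_nonneg_left h hc
  | mono hle _ h =>
    have := mul_le_mul_of_nonneg_right hle hB
    linarith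

end RectCone

open Classical in
/-- A deterministic protocol that exchanges at most `C` bits on the rectangle `A ×ˢ B` splits it
into at most `2 ^ C` rectangles of constant output. -/
lemma rectCone_protocol {X Y : Type} (z : Bool) (p : Protocol X Y) :
    ∀ (C : ℕ) (A : Set X) (B : Set Y), (∀ x ∈ A, ∀ y ∈ B, p.bits x y ≤ C) →
      RectCone (2 ^ C) fun x y =>
        if x ∈ A ∧ y ∈ B ∧ p.output x y = z then (1 : ℝ) else 0 := by
  have hzero : ∀ (C : ℕ), RectCone (2 ^ C) fun (_ : X) (_ : Y) => (0 : ℝ) :=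
    fun C => RectCone.zero.mono (by positivity)
  induction p with
  | leaf o =>
    intro C A B _
    by_cases ho : o = z
    · have h := RectCone.rect (X := X) (Y := Y) (fun x => if x ∈ A then 1 else 0)
        (fun y => if y ∈ B then 1 else 0) (fun x => by split_ifs <;> norm_num)
        (fun x => by split_ifs <;> norm_num) (fun x => by split_ifs <;> norm_num)
        (fun x => by split_ifs <;> norm_num)
      convert h.mono (one_le_pow₀ (one_le_two (α := ℝ)) (n := C)) using 3 with x y
      by_cases hx : x ∈ A <;> by_cases hy : y ∈ B <;> simp [hx, hy, Protocol.output, ho]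
    · simpa [Protocol.output, ho] using hzero C
  | alice send p q ihp ihq =>
    intro C A B hC
    by_cases hne : ∃ x ∈ A, ∃ y ∈ B, True
    · obtain ⟨x₀, hx₀, y₀, hy₀, -⟩ := hne
      have h0 := hC x₀ hx₀ y₀ hy₀
      simp only [Protocol.bits] at h0
      obtain ⟨C, rfl⟩ : ∃ C', C = C' + 1 := ⟨C - 1, by omega⟩
      have hp := ihp C (A ∩ {x | send x = false}) B fun x hx y hy => by
        have := hC x hx.1 y hy
        have hs : send x = false := hx.2
        simpa [Protocol.bits, hs] using this
      have hq := ihq C (A ∩ {x | send x = true}) B fun x hx y hy => by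
        have := hC x hx.1 y hy
        have hs : send x = true := hx.2
        simpa [Protocol.bits, hs] using this
      convert hp.add hq using 1
      · ring
      · ext x y
        cases hs : send x <;> simp [Protocol.output, hs]
    · have : ∀ x y, ¬(x ∈ A ∧ y ∈ B ∧ (Protocol.alice send p q).output x y = z) :=
        fun x y h => hne ⟨x, h.1, y, h.2.1, trivial⟩
      simpa [this] using hzero C
  | bob send p q ihp ihq =>
    intro C A B hC
    by_cases hne : ∃ x ∈ A, ∃ y ∈ B, True
    · obtain ⟨x₀, hx₀, y₀, hy₀, -⟩ := hne
      have h0 := hC x₀ hx₀ y₀ hy₀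
      simp only [Protocol.bits] at h0
      obtain ⟨C, rfl⟩ : ∃ C', C = C' + 1 := ⟨C - 1, by omega⟩
      have hp := ihp C A (B ∩ {y | send y = false}) fun x hx y hy => by
        have := hC x hx y hy.1
        have hs : send y = false := hy.2
        simpa [Protocol.bits, hs] using this
      have hq := ihq C A (B ∩ {y | send y = true}) fun x hx y hy => by
        have := hC x hx y hy.1
        have hs : send y = true := hy.2
        simpa [Protocol.bits, hs] using this
      convert hp.add hq using 1
      · ring
      · ext x y
        cases hs : send y <;> simp [Protocol.output, hs]
    · have : ∀ x y, ¬(x ∈ A ∧ y ∈ B ∧ (Protocol.bob send p q).output x y = z) :=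
        fun x y h => hne ⟨x, h.1, y, h.2.1, trivial⟩
      simpa [this] using hzero C

/-- On finite input sets the output distribution of a randomized protocol is a finite convex
combination of deterministic ones. -/
lemma rectCone_randomizedProtocol {X Y : Type} [Finite X] [Finite Y]
    (P : RandomizedProtocol X Y) (z : Bool) {C : ℕ}
    (hC : ∀ ω x y, (P.proto ω).bits x y ≤ C) :
    letI := P.measurableSpace
    RectCone (2 ^ C) fun x y => P.μ.real {ω | (P.proto ω).output x y = z} := by
  classical
  let := P.measurableSpace
  have := P.isProbabilityMeasure
  have := Fintype.ofFinite X
  have := Fintype.ofFinite Y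
  let O : P.Ω → X → Y → Bool := fun ω => (P.proto ω).output
  have hO : Measurable O := measurable_pi_lambda _ fun x => measurable_pi_lambda _ fun y =>
    P.measurable_output x y
  have hfib : ∀ F : X → Y → Bool, MeasurableSet (O ⁻¹' {F}) := fun F =>
    hO (MeasurableSet.singleton F)
  have hone : ∑ F, P.μ.real (O ⁻¹' {F}) = 1 := by
    rw [sum_measureReal_preimage_singleton _ fun F _ => hfib F]
    simp
  have hcone : ∀ F ∈ (Finset.univ : Finset (X → Y → Bool)),
      RectCone (P.μ.real (O ⁻¹' {F}) * 2 ^ C)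
        fun x y => P.μ.real (O ⁻¹' {F}) * if F x y = z then (1 : ℝ) else 0 := by
    intro F _
    rcases (O ⁻¹' {F}).eq_empty_or_nonempty with he | ⟨ω, hω⟩
    · simpa [he] using RectCone.zero
    · have h := rectCone_protocol z (P.proto ω) C Set.univ Set.univ fun x _ y _ => hC ω x y
      have hF : F = (P.proto ω).output := hω.symm
      rw [hF] at *
      simp only [Set.mem_univ, true_and] at h
      exact h.smul _ measureReal_nonneg
  have h := RectCone.sum _ hcone
  rw [← Finset.sum_mul, hone, one_mul] at h
  convert h using 3 with x y
  have h1 : {ω | (P.proto ω).output x y = z}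
      = O ⁻¹' (Finset.univ.filter fun F : X → Y → Bool => F x y = z : Finset _) := by
    ext ω; simp [O]
  rw [h1, ← sum_measureReal_preimage_singleton _ fun F _ => hfib F, Finset.sum_filter]
  simp only [mul_ite, mul_one, mul_zero]

/-! ### The lower bound and the padding reduction -/

/-- A function of small rectangle weight cannot separate `corr x y ≥ -√n / 4` from
`corr x y < -√n / 2`, even with error `1 / 3`. Testing both `(x, y)` and `(x, ¬y)` twenty times
gives a function `q` of the pair that is at least `(2 / 3) ^ 40` where `|corr|` is small and at most
`(1 / 3) ^ 20` where it is large. The first bound is the larger one, so `q` has a clearly negative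
correlation with `corr x y ^ 2 - n / 4`. -/
lemma exp_le_of_rectCone {κ : Type} [Fintype κ] [DecidableEq κ] [Nonempty κ] {N : ℝ}
    {p : (κ ⊕ κ → Bool) → (κ ⊕ κ → Bool) → ℝ} (hp : RectCone N p)
    (hp0 : ∀ x y, 0 ≤ p x y) (hp1 : ∀ x y, p x y ≤ 1)
    (hhigh : ∀ x y, -(√(Fintype.card (κ ⊕ κ)) / 4) ≤ corr x y → 2 / 3 ≤ p x y)
    (hlow : ∀ x y, corr x y < -(√(Fintype.card (κ ⊕ κ)) / 2) → p x y ≤ 1 / 3) :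
    Real.exp ((Fintype.card (κ ⊕ κ) : ℝ) / 1600) ≤ 3 ^ 20 * N ^ 40 := by
  set M := Fintype.card (κ ⊕ κ) with hM
  set m : ℝ := (M : ℝ) with hm
  have hm0 : 0 < m := by rw [hm, hM]; exact_mod_cast Fintype.card_pos
  have hsq : √m ^ 2 = m := Real.sq_sqrt hm0.le
  let r : (κ ⊕ κ → Bool) → (κ ⊕ κ → Bool) → ℝ := fun x y => p x y * p x fun i => !y i
  have hr0 : ∀ x y, 0 ≤ r x y := fun x y => mul_nonneg (hp0 _ _) (hp0 _ _)
  have hcone : RectCone (N ^ 40) fun x y => r x y ^ 20 := by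
    have h := (hp.mul (hp.comp id fun y i => !y i)).pow 20
    rwa [← sq, ← pow_mul] at h
  have hlb := hcone.neg_mul_le_sum (fun x y => corr x y ^ 2 - m / 4)
    (B := m / 4 * 4 ^ M * Real.exp (-m / 1600)) (by positivity)
    fun a b ha0 ha1 hb0 hb1 => rectangle_lower_bound ha0 ha1 hb0 hb1
  have hpoint : ∀ x y, r x y ^ 20 * (corr x y ^ 2 - m / 4)
      ≤ -((4 / 9) ^ 20 * (3 / 16) * m) * (if |corr x y| ≤ √m / 4 then 1 else 0)
        + (1 / 3) ^ 20 * corr x y ^ 2 := by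
    intro x y
    have hneg := corr_not_right x y
    split_ifs with h1
    · obtain ⟨h2, h3⟩ := abs_le.1 h1
      have hr : 4 / 9 ≤ r x y := by
        have := mul_le_mul (hhigh x y h2) (hhigh x (fun i => !y i) (by rw [hneg]; linarith))
          (by norm_num) (hp0 x y)
        simp only [r]; linarith
      have hr' := pow_le_pow_left₀ (by norm_num) hr 20
      have hs : corr x y ^ 2 ≤ m / 16 := by
        have := sq_le_sq' h2 h3
        nlinarith
      have h4 : r x y ^ 20 * (corr x y ^ 2 - m / 4) ≤ (4 / 9) ^ 20 * (corr x y ^ 2 - m / 4) :=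
        mul_le_mul_of_nonpos_right hr' (by linarith)
      have h5 : ((4 / 9) ^ 20 : ℝ) * (corr x y ^ 2 - m / 4) ≤ (4 / 9) ^ 20 * (-(3 / 16) * m) :=
        mul_le_mul_of_nonneg_left (by linarith) (by positivity)
      have h6 : 0 ≤ (1 / 3 : ℝ) ^ 20 * corr x y ^ 2 := by positivity
      linarith
    · rw [mul_zero, zero_add]
      by_cases h2 : corr x y ^ 2 ≤ m / 4
      · have h3 : r x y ^ 20 * (corr x y ^ 2 - m / 4) ≤ 0 :=
          mul_nonpos_of_nonneg_of_nonpos (pow_nonneg (hr0 x y) _) (by linarith)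
        have h4 : 0 ≤ (1 / 3 : ℝ) ^ 20 * corr x y ^ 2 := by positivity
        linarith
      · have h3 : √m / 2 < |corr x y| := by
          apply lt_of_pow_lt_pow_left₀ 2 (abs_nonneg _)
          rw [sq_abs, div_pow, hsq]; linarith
        have hr : r x y ≤ 1 / 3 := by
          rcases lt_abs.1 h3 with h4 | h4
          · have h5 := hlow x (fun i => !y i) (by rw [hneg]; linarith)
            exact (mul_le_of_le_one_left (hp0 _ _) (hp1 _ _)).trans h5
          · have h5 := hlow x y (by linarith)
            exact (mul_le_of_le_one_right (hp0 _ _) (hp1 _ _)).trans h5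
        have hr' := pow_le_pow_left₀ (hr0 x y) hr 20
        exact mul_le_mul hr' (by linarith) (by linarith) (by positivity)
  have hub : ∑ x, ∑ y, r x y ^ 20 * (corr x y ^ 2 - m / 4) ≤ -((1 / 3) ^ 20 * (m * 4 ^ M)) := by
    have h4 : (4 : ℝ) ^ M = 2 ^ M * 2 ^ M := by rw [← mul_pow]; norm_num
    rw [Finset.sum_comm]
    calc ∑ y, ∑ x, r x y ^ 20 * (corr x y ^ 2 - m / 4)
        ≤ ∑ _y : κ ⊕ κ → Bool, -((1 / 3) ^ 20 * (m * 2 ^ M)) := by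
          refine Finset.sum_le_sum fun y _ => ?_
          refine (Finset.sum_le_sum fun x _ => hpoint x y).trans ?_
          rw [Finset.sum_add_distrib, ← Finset.mul_sum, ← Finset.mul_sum, sum_corr_sq]
          have h5 := mul_le_mul_of_nonneg_left (le_sum_corr_small y)
            (by positivity : 0 ≤ (4 / 9) ^ 20 * (3 / 16) * m)
          rw [← hM] at h5 ⊢
          have h6 : 0 < m * 2 ^ M := by positivity
          -- Numerically `(4 / 3) ^ 20 * (9 / 1024) ≥ 2`.
          have h7 : 2 * (1 / 3 : ℝ) ^ 20 ≤ (4 / 9) ^ 20 * (3 / 16) * (3 / 64) := by norm_num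
          have h8 := mul_le_mul_of_nonneg_right h7 h6.le
          linarith
      _ = _ := by
          simp only [Finset.sum_const, Finset.card_univ, Fintype.card_fun, Fintype.card_bool,
            nsmul_eq_mul, ← hM]
          rw [h4]; push_cast; ring
  have h1 : (1 / 3) ^ 20 * (m * 4 ^ M) ≤ N ^ 40 * (m / 4 * 4 ^ M * Real.exp (-m / 1600)) := by
    linarith
  have h2 : (m * 4 ^ M) * (1 / 3) ^ 20 ≤ (m * 4 ^ M) * (N ^ 40 / 4 * Real.exp (-m / 1600)) := by
    linarith
  have h3 := le_of_mul_le_mul_left h2 (by positivity)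
  have h4 : Real.exp (-m / 1600) = (Real.exp (m / 1600))⁻¹ := by rw [← Real.exp_neg]; congr 1; ring
  have hE := Real.exp_pos (m / 1600)
  rw [h4, ← div_eq_mul_inv, le_div_iff₀ hE, one_div, inv_pow, inv_mul_le_iff₀ (by positivity)] at h3
  have : 0 ≤ N ^ 40 := by positivity
  linarith

lemma corr_eq_card_sub_hammingDist {ι : Type*} [Fintype ι] (x y : ι → Bool) :
    corr x y = Fintype.card ι - 2 * hammingDist x y := by
  have h : ∀ b c : Bool, sgn b * sgn c = 1 - 2 * if b ≠ c then (1 : ℝ) else 0 := by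
    intro b c; cases b <;> cases c <;> norm_num
  simp only [corr, h, Finset.sum_sub_distrib, ← Finset.mul_sum, hammingDist, Finset.sum_boole]
  simp

/-- Alice's padding map: every bit is repeated `r` times, and `d` zeros are appended. -/
def padLeft {ι : Type} {r d n : ℕ} (e : (ι × Fin r) ⊕ Fin d ≃ Fin n) (x : ι → Bool) :
    Fin n → Bool :=
  fun i => Sum.elim (fun q => x q.1) (fun _ => false) (e.symm i)

/-- Bob's padding map: every bit is repeated `r` times, and `d` bits are appended, of which the
first `s` are ones. -/
def padRight {ι : Type} {r d n : ℕ} (e : (ι × Fin r) ⊕ Fin d ≃ Fin n) (s : ℕ) (y : ι → Bool) :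
    Fin n → Bool :=
  fun i => Sum.elim (fun q => y q.1) (fun j : Fin d => decide ((j : ℕ) < s)) (e.symm i)

lemma corr_pad {ι : Type} [Fintype ι] {r d n : ℕ} (e : (ι × Fin r) ⊕ Fin d ≃ Fin n) {s : ℕ}
    (hs : s ≤ d) (x y : ι → Bool) :
    corr (padLeft e x) (padRight e s y) = r * corr x y + (d - 2 * s) := by
  rw [corr, ← Equiv.sum_comp e, Fintype.sum_sum_type, Fintype.sum_prod_type]
  simp only [padLeft, padRight, Equiv.symm_apply_apply, Sum.elim_inl, Sum.elim_inr]
  congr 1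
  · simp [corr, Finset.mul_sum]
  · have h : ∀ j : Fin d, sgn false * sgn (decide ((j : ℕ) < s))
        = 1 - 2 * if (j : ℕ) < s then (1 : ℝ) else 0 := by
      intro j; by_cases hj : (j : ℕ) < s <;> simp [hj]; norm_num
    simp only [h, Finset.sum_sub_distrib, ← Finset.mul_sum, Finset.sum_boole]
    have hc : (Finset.univ.filter fun j : Fin d => (j : ℕ) < s).card = s := by
      rw [Fin.card_filter_val_lt, min_eq_right hs]
    rw [hc]
    simp

/-- The lower bound for a single protocol. Inputs of length `m = 2 * k`, `k = n / 16384`, are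
stretched to length `n` by repeating every bit `4096` times and by padding that shifts the inner
product by about `1536 * √m`. -/
lemma cost_lower_bound {n C : ℕ} (hn : 16384 ≤ n)
    (P : RandomizedProtocol (Fin n → Bool) (Fin n → Bool))
    (hP : P.ComputesWithError (ghd n ((n : ℝ) / 2) (√(n : ℝ))) (1 / 3))
    (hC : ∀ ω x y, (P.proto ω).bits x y ≤ C) :
    (n : ℝ) / (16384 * 64000) - 1 ≤ C := by
  obtain ⟨k, hk⟩ : ∃ k, k = n / 16384 := ⟨_, rfl⟩
  have hk1 : 1 ≤ k := by omega
  have hkn : 16384 * k ≤ n := by omega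
  have hnk : n ≤ 32768 * k := by omega
  have : Nonempty (Fin k) := ⟨⟨0, hk1⟩⟩
  have hcard : Fintype.card (Fin k ⊕ Fin k) = 2 * k := by simp; ring
  set d := n - 8192 * k with hd
  have hdk : 8192 * k ≤ d := by omega
  have hcard2 : Fintype.card (((Fin k ⊕ Fin k) × Fin 4096) ⊕ Fin d) = n := by
    rw [Fintype.card_sum, Fintype.card_prod, hcard, Fintype.card_fin, Fintype.card_fin]
    omega
  let e := Fintype.equivFinOfCardEq hcard2
  set m : ℝ := ((Fintype.card (Fin k ⊕ Fin k) : ℕ) : ℝ) with hm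
  have hmk : m = 2 * k := by rw [hm, hcard]; push_cast; ring
  have hk1' : (1 : ℝ) ≤ k := by exact_mod_cast hk1
  have hnk' : (n : ℝ) ≤ 32768 * k := by exact_mod_cast hnk
  have hdk' : (8192 : ℝ) * k ≤ d := by exact_mod_cast hdk
  set w := √m with hw
  have hw2 : w ^ 2 = m := Real.sq_sqrt (by linarith)
  have hw1 : 1 ≤ w := Real.one_le_sqrt.2 (by linarith)
  have hsn : √(n : ℝ) ≤ 128 * w := by
    rw [Real.sqrt_le_left (by positivity), mul_pow, hw2]; linarith
  have hdw : 1536 * w ≤ d := by nlinarith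
  set s := ⌊((d : ℝ) - 1536 * w) / 2⌋₊ with hs
  have hs1 : (s : ℝ) ≤ (d - 1536 * w) / 2 := Nat.floor_le (by linarith)
  have hs2 : (d - 1536 * w) / 2 < (s : ℝ) + 1 := Nat.lt_floor_add_one _
  have hsd : s ≤ d := by
    have : (s : ℝ) ≤ d := by linarith
    exact_mod_cast this
  let := P.measurableSpace
  have := P.isProbabilityMeasure
  have hpad := corr_pad e hsd
  have hham := fun x y => corr_eq_card_sub_hammingDist (padLeft e x) (padRight e s y)
  simp only [Fintype.card_fin, hpad] at hham
  push_cast at hham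
  have hcone := (rectCone_randomizedProtocol P false hC).comp (padLeft e) (padRight e s)
  have hexp := exp_le_of_rectCone hcone (fun x y => measureReal_nonneg)
    (fun x y => measureReal_le_one) (fun x y hxy => ?_) (fun x y hxy => ?_)
  · have h3 : (3 : ℝ) ^ 20 ≤ Real.exp 40 := by
      have := Real.add_one_le_exp (2 : ℝ)
      calc (3 : ℝ) ^ 20 ≤ (Real.exp 2) ^ 20 := by gcongr; linarith
        _ = _ := by rw [← Real.exp_nat_mul]; norm_num
    have h2 : ((2 : ℝ) ^ C) ^ 40 ≤ Real.exp (40 * C) := by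
      have := Real.add_one_le_exp (1 : ℝ)
      calc ((2 : ℝ) ^ C) ^ 40 ≤ ((Real.exp 1) ^ C) ^ 40 := by gcongr; linarith
        _ = _ := by rw [← Real.exp_nat_mul, ← Real.exp_nat_mul]; norm_num
    have h4 : Real.exp (m / 1600) ≤ Real.exp (40 + 40 * C) := by
      rw [Real.exp_add]
      exact hexp.trans (mul_le_mul h3 h2 (by positivity) (by positivity))
    have h5 := Real.exp_le_exp.1 h4
    rw [div_le_iff₀ (by norm_num)] at h5
    rw [sub_le_iff_le_add, div_le_iff₀ (by norm_num)]
    linarith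
  · have hval : ghd n ((n : ℝ) / 2) (√(n : ℝ)) (padLeft e x) (padRight e s y) = some false := by
      rw [ghd, if_pos]
      have := hham x y
      linarith
    have h := hP _ _ _ hval
    have hmeas : MeasurableSet {ω | (P.proto ω).output (padLeft e x) (padRight e s y) = false} :=
      P.measurable_output _ _ (MeasurableSet.singleton false)
    have hcompl := probReal_compl_eq_one_sub (μ := P.μ) hmeas
    have : P.μ.real {ω | (P.proto ω).output (padLeft e x) (padRight e s y) = false}ᶜ ≤ 1 / 3 := h
    linarith
  · have hval : ghd n ((n : ℝ) / 2) (√(n : ℝ)) (padLeft e x) (padRight e s y) = some true := by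
      have := hham x y
      have h0 := Real.sqrt_nonneg (n : ℝ)
      rw [ghd, if_neg (by linarith), if_pos (by linarith)]
    have h := hP _ _ _ hval
    simpa only [ne_eq, Bool.not_eq_true] using h

end GapHamming

theorem theorem2p4 :
    ∃ c : ℝ, 0 < c ∧ ∀ᶠ n : ℕ in atTop,
      ENNReal.ofReal (c * (n : ℝ)) ≤
        (CommComplexity.randomizedComplexity (1 / 3)
          (CommComplexity.ghd n ((n : ℝ) / 2) (Real.sqrt (n : ℝ))) : ℝ≥0∞) := by
  refine ⟨1 / (2 * (16384 * 64000)), by norm_num, ?_⟩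
  filter_upwards [eventually_ge_atTop (2 * (16384 * 64000))] with n hn
  have hn' : ((2 * (16384 * 64000) : ℕ) : ℝ) ≤ n := by exact_mod_cast hn
  push_cast at hn'
  rcases eq_or_ne (CommComplexity.randomizedComplexity (1 / 3)
    (CommComplexity.ghd n ((n : ℝ) / 2) (Real.sqrt (n : ℝ)))) ⊤ with htop | htop
  · rw [htop, ENat.toENNReal_top]; exact le_top
  · obtain ⟨C, hC⟩ := ENat.ne_top_iff_exists.1 htop
    rw [← hC]
    -- A complexity of `C` is attained by some protocol, the cost being an extended natural number.
    have hlt : CommComplexity.randomizedComplexity (1 / 3)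
        (CommComplexity.ghd n ((n : ℝ) / 2) (Real.sqrt (n : ℝ))) < ((C + 1 : ℕ) : ℕ∞) := by
      rw [← hC]; exact_mod_cast Nat.lt_succ_self C
    obtain ⟨P, hlt⟩ := iInf_lt_iff.1 hlt
    obtain ⟨hP, hlt⟩ := iInf_lt_iff.1 hlt
    have hbits : ∀ ω x y, (P.proto ω).bits x y ≤ C := by
      intro ω x y
      have h1 : ((P.proto ω).bits x y : ℕ∞) ≤ P.cost :=
        le_iSup_of_le ω (le_iSup_of_le x (le_iSup_of_le y le_rfl))
      have h2 := h1.trans_lt hlt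
      exact Nat.lt_succ_iff.1 (by exact_mod_cast h2)
    have h := GapHamming.cost_lower_bound (by linarith) P hP hbits
    have h3 : 1 / (2 * (16384 * 64000)) * (n : ℝ) ≤ (C : ℝ) := by
      refine le_trans ?_ h
      linarith
    rw [ENat.toENNReal_coe, ← ENNReal.ofReal_natCast]
    exact ENNReal.ofReal_le_ofReal h3
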